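/- For a compact set $E\subset\mathbb C$, let $\gamma(E)=\sup|f'(\infty)|$, where the supremum is over all analytic $f:\mathbb C\setminus E\to\mathbb C$ with $|f|\le 1$ on $\mathbb C\setminus E$ (the analytic capacity of $E$), and let $\alpha(E)=\sup|f'(\infty)|$, where the supremum is over all continuous $f:\mathbb C\to\mathbb C$ with $|f|\le 1$ on $\mathbb C$ that are analytic on $\mathbb C\setminus E$ (the continuous analytic capacity of $E$). Here $f(\infty)=\lim_{z\to\infty}f(z)$ and $f'(\infty)=\lim_{z\to\infty}z\,(f(z)-f(\infty))$. **Proposition 1.2.** Let $\varphi:\mathbb C\to\mathbb C$ be a homeomorphism such that at least one of the following holds: 1. there is a constant $C>0$ such that $C^{-1}\gamma(E)\le\gamma(\varphi(E))\le C\,\gamma(E)$ for all compact sets $E\subset\mathbb C$; 2. there is a constant $C>0$ such that $C^{-1}\alpha(E)\le\alpha(\varphi(E))\le C\,\alpha(E)$ for all compact sets $E\subset\mathbb C$. Then $\varphi$ is bilipschitz, that is, $\varphi$ is bijective and there is a constant $L>0$ such that $L^{-1}|z-w|\le|\varphi(z)-\varphi(w)|\le L\,|z-w|$ for all $z,w\in\mathbb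 C$. -/

import Mathlib

open Filter Topology

/-- `c` is the derivative of `f` at infinity: the limit `f(∞) = lim_{z → ∞} f z` exists and
`c = lim_{z → ∞} z * (f z - f(∞))`. Here `z → ∞` means that `z` leaves every compact subset of
the plane, so only the values of `f` outside a compact set matter. -/
def HasDerivAtInfinity (f : ℂ → ℂ) (c : ℂ) : Prop :=
  ∃ a : ℂ, Tendsto f (cocompact ℂ) (𝓝 a) ∧
    Tendsto (fun z => z * (f z - a)) (cocompact ℂ) (𝓝 c)

/-- The numbers `|f'(∞)|`, where `f` is analytic and bounded by `1` on the complement of `E`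
(the values of `f` on `E` play no role). For compact `E` every such `f` has a derivative at
infinity. -/
def analyticCapacityValues (E : Set ℂ) : Set ℝ :=
  {t | ∃ (f : ℂ → ℂ) (c : ℂ), DifferentiableOn ℂ f Eᶜ ∧ (∀ z ∈ Eᶜ, ‖f z‖ ≤ 1) ∧
    HasDerivAtInfinity f c ∧ t = ‖c‖}

/-- The numbers `|f'(∞)|`, where `f` is continuous and bounded by `1` on the whole plane and
analytic on the complement of `E`. -/
def continuousAnalyticCapacityValues (E : Set ℂ) : Set ℝ :=
  {t | ∃ (f : ℂ → ℂ) (c : ℂ), Continuous f ∧ DifferentiableOn ℂ f Eᶜ ∧ (∀ z, ‖f z‖ ≤ 1) ∧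
    HasDerivAtInfinity f c ∧ t = ‖c‖}

/-- The analytic capacity `γ(E)` of a compact set `E`. -/
noncomputable def analyticCapacity (E : Set ℂ) : ℝ :=
  sSup (analyticCapacityValues E)

/-- The continuous analytic capacity `α(E)` of a compact set `E`. -/
noncomputable def continuousAnalyticCapacity (E : Set ℂ) : ℝ :=
  sSup (continuousAnalyticCapacityValues E)

/-- A bijection of the plane that distorts distances at most by a constant factor. -/
def IsBilipschitz (φ : ℂ → ℂ) : Prop :=
  Function.Bijective φ ∧ ∃ L : ℝ, 0 < L ∧
    ∀ z w : ℂ, L⁻¹ * ‖z - w‖ ≤ ‖φ z - φ w‖ ∧ ‖φ z - φ w‖ ≤ L * ‖z - w‖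

/-! The suprema above are suprema of nonempty sets of reals that are bounded above, so they
are genuine. -/

theorem zero_mem_analyticCapacityValues (E : Set ℂ) : 0 ∈ analyticCapacityValues E :=
  ⟨fun _ => 0, 0, differentiableOn_const 0, by simp, ⟨0, tendsto_const_nhds, by simp⟩, by simp⟩

theorem zero_mem_continuousAnalyticCapacityValues (E : Set ℂ) :
    0 ∈ continuousAnalyticCapacityValues E :=
  ⟨fun _ => 0, 0, continuous_const, differentiableOn_const 0, by simp,
    ⟨0, tendsto_const_nhds, by simp⟩, by simp⟩

theorem bddAbove_analyticCapacityValues {E : Set ℂ} (hE : IsCompact E) :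
    BddAbove (analyticCapacityValues E) := by
  obtain ⟨R, hR0, hR⟩ := hE.isBounded.exists_pos_norm_le
  refine ⟨R + 1, ?_⟩
  rintro t ⟨f, c, hf, hb, ⟨a, ha, hc⟩, rfl⟩
  have hinv : Tendsto (fun w : ℂ => w⁻¹) (𝓝[≠] 0) (cocompact ℂ) := by
    rw [← Metric.cobounded_eq_cocompact]
    exact tendsto_inv₀_nhdsNE_zero
  set g : ℂ → ℂ := fun w => if w = 0 then a else f w⁻¹ with hg
  have hout : ∀ w : ℂ, w ≠ 0 → ‖w‖ ≤ (R + 1)⁻¹ → w⁻¹ ∈ Eᶜ := by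
    intro w hw hwn hwE
    have h1 := hR _ hwE
    have h2 : R + 1 ≤ ‖w⁻¹‖ := by
      rw [norm_inv]
      exact (le_inv_comm₀ (norm_pos_iff.2 hw) (by positivity)).1 hwn
    linarith
  have h0 : HasDerivAt g c 0 := by
    rw [hasDerivAt_iff_tendsto_slope]
    refine (hc.comp hinv).congr' ?_
    filter_upwards [self_mem_nhdsWithin] with w hw
    have hw' : w ≠ 0 := hw
    simp [hg, slope_def_field, hw']
    field_simp
  have hopen : IsOpen Eᶜ := hE.isClosed.isOpen_compl
  have hd : ∀ w ∈ Metric.closedBall (0 : ℂ) (R + 1)⁻¹, DifferentiableAt ℂ g w := by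
    intro w hw
    by_cases hw0 : w = 0
    · subst hw0
      exact h0.differentiableAt
    · have h1 : DifferentiableAt ℂ f w⁻¹ :=
        hf.differentiableAt (hopen.mem_nhds (hout w hw0 (by simpa using hw)))
      have h2 : DifferentiableAt ℂ (fun w => f w⁻¹) w :=
        DifferentiableAt.comp w h1 (differentiableAt_inv hw0)
      refine h2.congr_of_eventuallyEq ?_
      filter_upwards [isOpen_ne.mem_nhds hw0] with v hv
      have hv' : v ≠ 0 := hv
      simp [hg, hv']
  have hpos : 0 < (R + 1)⁻¹ := by positivity
  have key := Complex.norm_deriv_le_of_forall_mem_sphere_norm_le (f := g) (c := 0) (C := 1) hpos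
    (DifferentiableOn.diffContOnCl_ball (U := Metric.closedBall 0 (R + 1)⁻¹)
      (fun w hw => (hd w hw).differentiableWithinAt) subset_rfl) (by
      intro w hw
      have hn : ‖w‖ = (R + 1)⁻¹ := by simpa using hw
      have hw0 : w ≠ 0 := by
        rintro rfl
        simp at hn
        linarith
      simpa [hg, hw0] using hb _ (hout w hw0 hn.le))
  rw [h0.deriv] at key
  simpa using key

theorem bddAbove_continuousAnalyticCapacityValues {E : Set ℂ} (hE : IsCompact E) :
    BddAbove (continuousAnalyticCapacityValues E) := by
  refine (bddAbove_analyticCapacityValues hE).mono ?_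
  rintro t ⟨f, c, _, hd, hb, hc, ht⟩
  exact ⟨f, c, hd, fun z _ => hb z, hc, ht⟩

open Metric Set unitInterval

/-! Both capacities behave like a length: a disc of radius `R` has capacity at most `2 * R`, while a
path-connected compact set has analytic capacity at least its diameter over 24. The image of a
segment from `z` to `w` is path-connected and lies in the image of a disc of radius comparable to
`‖z - w‖`, so the upper capacity bound makes `φ` Lipschitz. The lower bound says the same of the
inverse. An arc can have zero continuous analytic capacity, so the lower estimate is used for a
compact set with the arc in its interior. -/

/-! ### Comparison of the two capacities -/

theorem le_analyticCapacity {E : Set ℂ} (hE : IsCompact E) {f : ℂ → ℂ} {c : ℂ}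
    (hf : DifferentiableOn ℂ f Eᶜ) (hb : ∀ z ∈ Eᶜ, ‖f z‖ ≤ 1) (hc : HasDerivAtInfinity f c) :
    ‖c‖ ≤ analyticCapacity E :=
  le_csSup (bddAbove_analyticCapacityValues hE) ⟨f, c, hf, hb, hc, rfl⟩

theorem le_continuousAnalyticCapacity {E : Set ℂ} (hE : IsCompact E) {f : ℂ → ℂ} {c : ℂ}
    (hcont : Continuous f) (hf : DifferentiableOn ℂ f Eᶜ) (hb : ∀ z, ‖f z‖ ≤ 1)
    (hc : HasDerivAtInfinity f c) : ‖c‖ ≤ continuousAnalyticCapacity E :=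
  le_csSup (bddAbove_continuousAnalyticCapacityValues hE) ⟨f, c, hcont, hf, hb, hc, rfl⟩

theorem analyticCapacity_mono {K E : Set ℂ} (hE : IsCompact E) (h : K ⊆ E) :
    analyticCapacity K ≤ analyticCapacity E := by
  refine csSup_le ⟨0, zero_mem_analyticCapacityValues K⟩ ?_
  rintro t ⟨f, c, hf, hb, hc, rfl⟩
  have hsub : Eᶜ ⊆ Kᶜ := compl_subset_compl.2 h
  exact le_analyticCapacity hE (hf.mono hsub) (fun z hz => hb z (hsub hz)) hc

theorem continuousAnalyticCapacity_le_analyticCapacity {E : Set ℂ} (hE : IsCompact E) :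
    continuousAnalyticCapacity E ≤ analyticCapacity E := by
  refine csSup_le ⟨0, zero_mem_continuousAnalyticCapacityValues E⟩ ?_
  rintro t ⟨f, c, -, hf, hb, hc, rfl⟩
  exact le_analyticCapacity hE hf (fun z _ => hb z) hc

theorem HasDerivAtInfinity.congr' {f g : ℂ → ℂ} {c : ℂ} (hf : HasDerivAtInfinity f c)
    (h : f =ᶠ[cocompact ℂ] g) : HasDerivAtInfinity g c := by
  obtain ⟨a, ha, hc⟩ := hf
  refine ⟨a, ha.congr' h, hc.congr' ?_⟩
  filter_upwards [h] with z hz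
  rw [hz]

/-- A function analytic and bounded off a compact set `K` can be redefined inside any compact set
whose interior contains `K` so as to become continuous on the plane. -/
theorem analyticCapacity_le_continuousAnalyticCapacity_of_subset_interior {K E : Set ℂ}
    (hE : IsCompact E) (h : K ⊆ interior E) :
    analyticCapacity K ≤ continuousAnalyticCapacity E := by
  refine csSup_le ⟨0, zero_mem_analyticCapacityValues K⟩ ?_
  rintro t ⟨f, c, hf, hb, hc, rfl⟩
  have hsub : closure Eᶜ ⊆ Kᶜ := by
    rw [closure_compl]
    exact compl_subset_compl.2 h
  let f₀ : C(closure Eᶜ, ℂ) := ⟨_, (hf.continuousOn.mono hsub).domRestrict⟩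
  -- Tietze extension with values in the closed unit disc keeps the bound 1.
  obtain ⟨g, hg, hgf⟩ := f₀.exists_forall_mem_restrict_eq (t := closedBall (0 : ℂ) 1)
    isClosed_closure (fun x => mem_closedBall_zero_iff.2 (hb x (hsub x.2)))
  have heq : ∀ z ∈ Eᶜ, g z = f z := fun z hz =>
    congrArg (fun F : C(closure Eᶜ, ℂ) => F ⟨z, subset_closure hz⟩) hgf
  refine le_continuousAnalyticCapacity hE g.continuous
    ((hf.mono (subset_closure.trans hsub)).congr heq) (fun z => by simpa using hg z)
    (hc.congr' ?_)
  filter_upwards [hE.compl_mem_cocompact] with z hz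
  exact (heq z hz).symm

/-! ### Upper bound for discs -/

theorem HasDerivAtInfinity.comp_const_add {f : ℂ → ℂ} {c : ℂ} (hf : HasDerivAtInfinity f c)
    (p : ℂ) : HasDerivAtInfinity (fun z => f (p + z)) c := by
  obtain ⟨a, ha, hc⟩ := hf
  have hp : Tendsto (fun z => p + z) (cocompact ℂ) (cocompact ℂ) :=
    (Homeomorph.addLeft p).isClosedEmbedding.tendsto_cocompact
  have hfp := ha.comp hp
  refine ⟨a, hfp, ?_⟩
  have h1 : Tendsto (fun z => f (p + z) - a) (cocompact ℂ) (𝓝 0) := by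
    simpa using hfp.sub_const a
  have h2 := (hc.comp hp).sub (h1.const_mul p)
  simp only [mul_zero, sub_zero] at h2
  refine h2.congr fun z => ?_
  simp only [Function.comp_apply]
  ring

/-- Cauchy's estimate at 0 for `f w⁻¹`, whose derivative there is `c`. The radius `(2 * R)⁻¹` keeps
the closed disc of `w` inside the domain; the sharp constant is not needed. -/
theorem norm_le_of_hasDerivAtInfinity {f : ℂ → ℂ} {c : ℂ} {R : ℝ} (hR : 0 < R)
    (hf : DifferentiableOn ℂ f (closedBall 0 R)ᶜ) (hb : ∀ z ∈ (closedBall (0 : ℂ) R)ᶜ, ‖f z‖ ≤ 1)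
    (hc : HasDerivAtInfinity f c) : ‖c‖ ≤ 2 * R := by
  obtain ⟨a, ha, hc⟩ := hc
  have hinv : Tendsto (fun w : ℂ => w⁻¹) (𝓝[≠] 0) (cocompact ℂ) := by
    rw [← Metric.cobounded_eq_cocompact]
    exact tendsto_inv₀_nhdsNE_zero
  set g : ℂ → ℂ := Function.update (fun w => f w⁻¹) 0 a with hg
  have hout : ∀ w : ℂ, w ≠ 0 → ‖w‖ ≤ (2 * R)⁻¹ → w⁻¹ ∈ (closedBall (0 : ℂ) R)ᶜ := by
    intro w hw hwn
    have h2 : 2 * R ≤ ‖w⁻¹‖ := by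
      rw [norm_inv]
      exact (le_inv_comm₀ (norm_pos_iff.2 hw) (by positivity)).1 hwn
    simp only [mem_compl_iff, mem_closedBall, dist_zero_right, not_le]
    linarith
  have h0 : HasDerivAt g c 0 := by
    rw [hasDerivAt_iff_tendsto_slope]
    refine (hc.comp hinv).congr' ?_
    filter_upwards [self_mem_nhdsWithin] with w hw
    have hw' : w ≠ 0 := hw
    simp [hg, slope_def_field, hw']
    field_simp
  have hd : ∀ w ∈ closedBall (0 : ℂ) (2 * R)⁻¹, DifferentiableAt ℂ g w := by
    intro w hw
    by_cases hw0 : w = 0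
    · subst hw0
      exact h0.differentiableAt
    · have h1 : DifferentiableAt ℂ f w⁻¹ := hf.differentiableAt
        (isClosed_closedBall.isOpen_compl.mem_nhds (hout w hw0 (by simpa using hw)))
      refine (DifferentiableAt.comp w h1 (differentiableAt_inv hw0)).congr_of_eventuallyEq ?_
      filter_upwards [isOpen_ne.mem_nhds hw0] with v hv
      exact Function.update_of_ne hv _ _
  have hpos : 0 < (2 * R)⁻¹ := by positivity
  have key := Complex.norm_deriv_le_of_forall_mem_sphere_norm_le (f := g) (c := 0) (C := 1) hpos
    (DifferentiableOn.diffContOnCl_ball (U := closedBall 0 (2 * R)⁻¹)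
      (fun w hw => (hd w hw).differentiableWithinAt) subset_rfl) (by
      intro w hw
      have hn : ‖w‖ = (2 * R)⁻¹ := by simpa using hw
      have hw0 : w ≠ 0 := norm_pos_iff.1 (hn ▸ hpos)
      simpa [hg, hw0] using hb _ (hout w hw0 hn.le))
  rw [h0.deriv] at key
  simpa using key

theorem analyticCapacity_closedBall_le (p : ℂ) {R : ℝ} (hR : 0 < R) :
    analyticCapacity (closedBall p R) ≤ 2 * R := by
  refine csSup_le ⟨0, zero_mem_analyticCapacityValues _⟩ ?_
  rintro t ⟨f, c, hf, hb, hc, rfl⟩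
  have hmaps : ∀ z ∈ (closedBall (0 : ℂ) R)ᶜ, p + z ∈ (closedBall p R)ᶜ := by
    intro z hz
    simpa [mem_closedBall, dist_eq_norm] using hz
  exact norm_le_of_hasDerivAtInfinity hR
    (hf.comp (by fun_prop) hmaps) (fun z hz => hb _ (hmaps z hz)) (hc.comp_const_add p)

/-! ### Lower bound by the diameter -/

/-- A continuous square root of a nonvanishing analytic function is analytic. -/
theorem DifferentiableOn.of_sq {U : Set ℂ} (hU : IsOpen U) {u g : ℂ → ℂ}
    (hu : DifferentiableOn ℂ u U) (hg : ContinuousOn g U) (hgu : ∀ z ∈ U, g z ^ 2 = u z)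
    (h0 : ∀ z ∈ U, g z ≠ 0) : DifferentiableOn ℂ g U := by
  intro z hz
  have hUz : U ∈ 𝓝 z := hU.mem_nhds hz
  have hgc : ContinuousAt g z := hg.continuousAt hUz
  have hsum : Tendsto (fun w => g w + g z) (𝓝[≠] z) (𝓝 (g z + g z)) :=
    (hgc.tendsto.mono_left nhdsWithin_le_nhds).add_const _
  have hne : g z + g z ≠ 0 := by
    rw [← two_mul]
    exact mul_ne_zero two_ne_zero (h0 z hz)
  have hslope := hasDerivAt_iff_tendsto_slope.1 ((hu.differentiableAt hUz).hasDerivAt)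
  -- Divide the slope of `u` by `g w + g z`, since `u w - u z = (g w - g z) * (g w + g z)`.
  have hder : HasDerivAt g (_root_.deriv u z / (g z + g z)) z := by
    rw [hasDerivAt_iff_tendsto_slope]
    refine (hslope.div hsum hne).congr' ?_
    filter_upwards [hsum.eventually_ne hne, self_mem_nhdsWithin, mem_nhdsWithin_of_mem_nhds hUz]
      with w hw hwz hwU
    have hwz' : w - z ≠ 0 := sub_ne_zero.2 hwz
    simp only [Pi.div_apply, slope_def_field]
    rw [← hgu w hwU, ← hgu z hz]
    field_simp
    ring
  exact hder.differentiableAt.differentiableWithinAt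

/-- If `a` and `b` are joined in `K`, then `(z - a) / (z - b)` has a square root off `K`, which is
the principal one where `z` is far from `K`. -/
theorem exists_sqrt_div_of_joinedIn {K : Set ℂ} {a b : ℂ} {R : ℝ} (hK : IsClosed K)
    (hab : JoinedIn K b a) (hR : K ⊆ closedBall b R) :
    ∃ g : ℂ → ℂ, DifferentiableOn ℂ g Kᶜ ∧ (∀ z ∈ Kᶜ, g z ^ 2 = (z - a) / (z - b)) ∧
      ∀ z ∈ Kᶜ, R < ‖z - b‖ → 0 < (g z).re := by
  obtain ⟨p, hp⟩ := hab
  have hpne : ∀ (t : I) (z : (Kᶜ : Set ℂ)), (z : ℂ) - p t ≠ 0 := fun t z h =>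
    z.2 (sub_eq_zero.1 h ▸ hp t)
  have hbne : ∀ z : (Kᶜ : Set ℂ), (z : ℂ) - b ≠ 0 := fun z => by simpa using hpne 0 z
  -- Moving the zero from `b` to `a` along the path deforms the constant 1 into `(z - a) / (z - b)`;
  -- the root 1 lifts along this homotopy through the squaring covering.
  let H : C(I × (Kᶜ : Set ℂ), {x : ℂ // x ≠ 0}) :=
    ⟨fun x => ⟨((x.2 : ℂ) - p x.1) / ((x.2 : ℂ) - b), div_ne_zero (hpne _ _) (hbne _)⟩, by
      refine Continuous.subtype_mk (Continuous.div₀ ?_ ?_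
        fun x : I × (Kᶜ : Set ℂ) => hbne x.2) _ <;> fun_prop⟩
  let e : C((Kᶜ : Set ℂ), {x : ℂ // x ≠ 0}) := ContinuousMap.const _ ⟨1, one_ne_zero⟩
  have hH0 : ∀ z, H (0, z) = (fun x : {x : ℂ // x ≠ 0} =>
      (⟨x ^ 2, pow_ne_zero 2 x.2⟩ : {x : ℂ // x ≠ 0})) (e z) := by
    intro z
    apply Subtype.ext
    simp [H, e, div_self (hbne z)]
  have cov := isCoveringMap_npow (𝕜 := ℂ) 2 two_ne_zero
  let G := cov.liftHomotopy H e hH0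
  have hG : ∀ t z, ((G (t, z) : {x : ℂ // x ≠ 0}) : ℂ) ^ 2 = ((z : ℂ) - p t) / ((z : ℂ) - b) :=
    fun t z => congrArg Subtype.val (congrFun (cov.liftHomotopy_lifts H e hH0) (t, z))
  have hG0 : ∀ z, ((G (0, z) : {x : ℂ // x ≠ 0}) : ℂ) = 1 := fun z =>
    congrArg Subtype.val (cov.liftHomotopy_zero H e hH0 z)
  classical
  let g : ℂ → ℂ := fun z => if hz : z ∈ Kᶜ then (G (1, ⟨z, hz⟩) : {x : ℂ // x ≠ 0}) else 0
  have hg : ∀ z (hz : z ∈ Kᶜ), g z = (G (1, ⟨z, hz⟩) : {x : ℂ // x ≠ 0}) := fun z hz => dif_pos hz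
  have hgsq : ∀ z ∈ Kᶜ, g z ^ 2 = (z - a) / (z - b) := by
    intro z hz
    rw [hg z hz, hG]
    simp
  have hgc : ContinuousOn g Kᶜ := by
    rw [continuousOn_iff_continuous_domRestrict]
    have h1 : Continuous fun z : (Kᶜ : Set ℂ) => ((G (1, z) : {x : ℂ // x ≠ 0}) : ℂ) := by fun_prop
    exact h1.congr fun z => (hg z z.2).symm
  refine ⟨g, ?_, hgsq, ?_⟩
  · have hu : DifferentiableOn ℂ (fun z => (z - a) / (z - b)) Kᶜ :=
      DifferentiableOn.div (by fun_prop) (by fun_prop) fun z hz => hbne ⟨z, hz⟩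
    refine DifferentiableOn.of_sq hK.isOpen_compl hu hgc hgsq fun z hz => ?_
    rw [hg z hz]
    exact (G (1, ⟨z, hz⟩)).2
  · intro z hz hzR
    let r : I → ℝ := fun t => ((G (t, ⟨z, hz⟩) : {x : ℂ // x ≠ 0}) : ℂ).re
    have hr : Continuous r := by fun_prop
    have hr0 : r 0 = 1 := by simp [r, hG0]
    -- A purely imaginary root has a square with nonpositive real part, but for such `z` the
    -- quotient stays at distance less than 1 from 1.
    have hrne : ∀ t, r t ≠ 0 := by
      intro t ht
      have h1 : (((z - p t) / (z - b) : ℂ)).re ≤ 0 := by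
        rw [← hG t ⟨z, hz⟩, sq, Complex.mul_re]
        have : ((G (t, ⟨z, hz⟩) : {x : ℂ // x ≠ 0}) : ℂ).re = 0 := ht
        rw [this]
        nlinarith [sq_nonneg ((G (t, ⟨z, hz⟩) : {x : ℂ // x ≠ 0}) : ℂ).im]
      have h2 : (z - p t) / (z - b) = 1 - (p t - b) / (z - b) := by
        have := hbne ⟨z, hz⟩
        field_simp
        ring
      have h3 : ‖(p t - b) / (z - b)‖ < 1 := by
        have hpt := hR (hp t)
        rw [mem_closedBall, dist_eq_norm] at hpt
        rw [norm_div, div_lt_one (norm_pos_iff.2 (hbne ⟨z, hz⟩))]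
        exact hpt.trans_lt hzR
      have h4 := (Complex.re_le_norm ((p t - b) / (z - b))).trans_lt h3
      rw [h2, Complex.sub_re, Complex.one_re] at h1
      linarith
    rw [hg z hz]
    by_contra hneg
    obtain ⟨t, ht⟩ := mem_range_of_exists_le_of_exists_ge hr
      ⟨1, not_lt.1 hneg⟩ ⟨0, hr0 ▸ zero_le_one⟩
    exact hrne t ht

/-- With `g` the square root of `(z - a) / (z - b)`, the function `1 / (3 * (g + 1))` is admissible.
At infinity `g` is `1 - (a - b) / (2 * z)` to first order, so its derivative there is `-(b - a) /
24`. -/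
theorem norm_sub_le_analyticCapacity_of_joinedIn {K : Set ℂ} {a b : ℂ} (hK : IsCompact K)
    (hab : JoinedIn K b a) (hR : K ⊆ closedBall b ‖b - a‖) :
    ‖b - a‖ ≤ 24 * analyticCapacity K := by
  rcases eq_or_ne b a with rfl | hne
  · simpa [analyticCapacity]
      using le_csSup (bddAbove_analyticCapacityValues hK) (zero_mem_analyticCapacityValues K)
  have hd : 0 < ‖b - a‖ := norm_pos_iff.2 (sub_ne_zero.2 hne)
  obtain ⟨g, hgd, hgsq, hgre⟩ := exists_sqrt_div_of_joinedIn hK.isClosed hab hR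
  have hbK : b ∈ K := hab.source_mem
  have hzb : ∀ z ∈ Kᶜ, z - b ≠ 0 := fun z hz h => hz (sub_eq_zero.1 h ▸ hbK)
  have hsub : ∀ z ∈ Kᶜ, g z ^ 2 - 1 = (b - a) / (z - b) := by
    intro z hz
    have := hzb z hz
    rw [hgsq z hz]
    field_simp
    ring
  -- If `g z` were near -1, then `g z ^ 2 - 1` would be small, so `z` would be far from `b`, where
  -- `g` has positive real part.
  have hlow : ∀ z ∈ Kᶜ, 1 / 3 ≤ ‖g z + 1‖ := by
    intro z hz
    by_contra! hlt
    have hfac : g z ^ 2 - 1 = (g z + 1) * ((g z + 1) - 2) := by ring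
    have h1 : ‖g z ^ 2 - 1‖ < 1 := by
      rw [hfac, norm_mul]
      have : ‖g z + 1 - 2‖ ≤ ‖g z + 1‖ + 2 := by simpa using norm_sub_le (g z + 1) 2
      nlinarith [norm_nonneg (g z + 1)]
    rw [hsub z hz, norm_div, div_lt_one (norm_pos_iff.2 (hzb z hz))] at h1
    have h2 := hgre z hz h1
    have h3 := Complex.re_le_norm (g z + 1)
    simp only [Complex.add_re, Complex.one_re] at h3
    linarith
  have hne0 : ∀ z ∈ Kᶜ, g z + 1 ≠ 0 := fun z hz h => by
    have := hlow z hz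
    rw [h, norm_zero] at this
    norm_num at this
  have hfar : ∀ᶠ z in cocompact ℂ, z ∈ Kᶜ ∧ ‖b - a‖ < ‖z - b‖ := by
    refine Filter.Eventually.and hK.compl_mem_cocompact ?_
    filter_upwards [(isCompact_closedBall b ‖b - a‖).compl_mem_cocompact] with z hz
    simpa [dist_eq_norm] using hz
  have hinv : Tendsto (fun z => (z - b)⁻¹) (cocompact ℂ) (𝓝 0) := by
    have h1 : Tendsto (fun z => z - b) (cocompact ℂ) (cocompact ℂ) :=
      (Homeomorph.subRight b).isClosedEmbedding.tendsto_cocompact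
    have h2 : Tendsto (fun z : ℂ => z⁻¹) (cocompact ℂ) (𝓝 0) := by
      rw [← Metric.cobounded_eq_cocompact]
      exact tendsto_inv₀_cobounded
    exact h2.comp h1
  have hquot : Tendsto (fun z => (b - a) / (z - b)) (cocompact ℂ) (𝓝 0) := by
    simpa [div_eq_mul_inv] using hinv.const_mul (b - a)
  have hg1 : Tendsto g (cocompact ℂ) (𝓝 1) := by
    rw [tendsto_iff_norm_sub_tendsto_zero]
    refine squeeze_zero' (Eventually.of_forall fun _ => norm_nonneg _) ?_
      (by simpa using hquot.norm)
    filter_upwards [hfar] with z hz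
    rw [← norm_div, ← hsub z hz.1, show g z ^ 2 - 1 = (g z - 1) * (g z + 1) by ring, norm_mul]
    have h1 := Complex.re_le_norm (g z + 1)
    have h2 := hgre z hz.1 hz.2
    simp only [Complex.add_re, Complex.one_re] at h1
    nlinarith [norm_nonneg (g z - 1)]
  have hg2 : Tendsto (fun z => g z + 1) (cocompact ℂ) (𝓝 2) := by
    simpa [one_add_one_eq_two] using hg1.add_const 1
  let F : ℂ → ℂ := fun z => (3 * (g z + 1))⁻¹
  have hFd : DifferentiableOn ℂ F Kᶜ :=
    ((hgd.add_const 1).const_mul 3).inv fun z hz => mul_ne_zero three_ne_zero (hne0 z hz)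
  have hFb : ∀ z ∈ Kᶜ, ‖F z‖ ≤ 1 := by
    intro z hz
    have := hlow z hz
    simp only [F, norm_inv, norm_mul, Complex.norm_ofNat]
    exact inv_le_one_of_one_le₀ (by linarith)
  have hFc : HasDerivAtInfinity F (-(b - a) / 24) := by
    refine ⟨(3 * 2)⁻¹, (hg2.const_mul 3).inv₀ (by norm_num), ?_⟩
    have hlim : Tendsto (fun z => (1 + b * (z - b)⁻¹) * (-(b - a) / (6 * (g z + 1) ^ 2)))
        (cocompact ℂ) (𝓝 ((1 + b * 0) * (-(b - a) / (6 * 2 ^ 2)))) :=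
      ((hinv.const_mul b).const_add 1).mul
        (tendsto_const_nhds.div ((hg2.pow 2).const_mul 6) (by norm_num))
    rw [show (1 + b * 0) * (-(b - a) / (6 * 2 ^ 2)) = -(b - a) / 24 by ring] at hlim
    refine hlim.congr' ?_
    filter_upwards [hfar] with z hz
    have h1 := hzb z hz.1
    have h2 := hne0 z hz.1
    have h3 : b - a = (g z ^ 2 - 1) * (z - b) := by
      rw [hsub z hz.1]
      field_simp
    simp only [F]
    rw [h3]
    field_simp
    ring
  have := le_analyticCapacity hK hFd hFb hFc
  rw [norm_div, norm_neg, Complex.norm_ofNat] at this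
  linarith

theorem IsPathConnected.diam_le_analyticCapacity {K : Set ℂ} (hK : IsCompact K)
    (hc : IsPathConnected K) : diam K ≤ 24 * analyticCapacity K := by
  -- A pair at maximal distance puts `K` inside the closed disc about `b` through `a`.
  obtain ⟨⟨b, a⟩, ⟨hb, ha⟩, hmax⟩ := (hK.prod hK).exists_isMaxOn (hc.nonempty.prod hc.nonempty)
    (f := fun x => dist x.1 x.2) (by fun_prop)
  have hmax' : ∀ x ∈ K, ∀ y ∈ K, dist x y ≤ ‖b - a‖ := fun x hx y hy => by
    simpa [dist_eq_norm] using hmax (mk_mem_prod hx hy)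
  exact (diam_le_of_forall_dist_le (norm_nonneg _) hmax').trans
    (norm_sub_le_analyticCapacity_of_joinedIn hK (hc.joinedIn b hb a ha)
      fun x hx => hmax' x hx b hb)

/-! ### From capacity to distances -/

/-- A homeomorphism of the plane is Lipschitz if it does not increase, by more than a constant
factor, a set function comparable to the diameter. -/
theorem Homeomorph.norm_sub_le_of_capacity_image_le {cap : Set ℂ → ℝ}
    (hlow : ∀ K E : Set ℂ, IsCompact K → IsPathConnected K → IsCompact E → K ⊆ interior E →
      diam K ≤ 24 * cap E)
    (hup : ∀ p R, 0 < R → cap (closedBall p R) ≤ 2 * R) (e : ℂ ≃ₜ ℂ) {C : ℝ} (hC : 0 ≤ C)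
    (h : ∀ E, IsCompact E → cap (e '' E) ≤ C * cap E) (z w : ℂ) :
    ‖e z - e w‖ ≤ 96 * C * ‖z - w‖ := by
  rcases eq_or_ne z w with rfl | hne
  · simp
  have hd : 0 < ‖z - w‖ := norm_pos_iff.2 (sub_ne_zero.2 hne)
  -- Doubling the radius puts the segment in the interior; then 96 is 24 · 2 · 2.
  have hball : IsCompact (closedBall z (2 * ‖z - w‖)) := isCompact_closedBall _ _
  have hz : z ∈ segment ℝ z w := left_mem_segment ℝ z w
  have hw : w ∈ segment ℝ z w := right_mem_segment ℝ z w
  have hseg : IsPathConnected (segment ℝ z w) := (convex_segment z w).isPathConnected ⟨z, hz⟩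
  have hsegc : IsCompact (segment ℝ z w) := by
    rw [segment_eq_image_lineMap]
    exact isCompact_Icc.image AffineMap.lineMap_continuous
  have hsub : segment ℝ z w ⊆ interior (closedBall z (2 * ‖z - w‖)) := by
    refine Subset.trans ?_ ball_subset_interior_closedBall
    refine (convex_ball z _).segment_subset (mem_ball_self (by positivity)) ?_
    rw [mem_ball', dist_eq_norm]
    linarith
  have h1 := hlow _ _ (hsegc.image e.continuous) (hseg.image e.continuous)
    (hball.image e.continuous) (by rw [← e.image_interior]; exact image_mono hsub)
  have h2 : dist (e z) (e w) ≤ diam (e '' segment ℝ z w) :=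
    dist_le_diam_of_mem (hsegc.image e.continuous).isBounded
      (mem_image_of_mem e hz) (mem_image_of_mem e hw)
  rw [dist_eq_norm] at h2
  have h3 := h _ hball
  have h4 := mul_le_mul_of_nonneg_left (hup z (2 * ‖z - w‖) (by positivity)) hC
  linarith

theorem IsHomeomorph.isBilipschitz_of_capacity {cap : Set ℂ → ℝ}
    (hlow : ∀ K E : Set ℂ, IsCompact K → IsPathConnected K → IsCompact E → K ⊆ interior E →
      diam K ≤ 24 * cap E)
    (hup : ∀ p R, 0 < R → cap (closedBall p R) ≤ 2 * R) {φ : ℂ → ℂ} (hφ : IsHomeomorph φ)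
    {C : ℝ} (hC : 0 < C)
    (h : ∀ E, IsCompact E → C⁻¹ * cap E ≤ cap (φ '' E) ∧ cap (φ '' E) ≤ C * cap E) :
    IsBilipschitz φ := by
  let e : ℂ ≃ₜ ℂ := hφ.homeomorph
  have he : ∀ z, e z = φ z := fun _ => rfl
  refine ⟨hφ.bijective, 96 * C, by positivity, fun z w => ⟨?_, ?_⟩⟩
  · have hsymm : ∀ E, IsCompact E → cap (e.symm '' E) ≤ C * cap E := by
      intro E hE
      have h1 := (h _ (hE.image e.symm.continuous)).1
      have h2 : φ '' (e.symm '' E) = E := e.toEquiv.image_symm_image E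
      rwa [h2, inv_mul_le_iff₀ hC] at h1
    have := e.symm.norm_sub_le_of_capacity_image_le hlow hup hC.le hsymm (e z) (e w)
    rw [e.symm_apply_apply, e.symm_apply_apply] at this
    rwa [inv_mul_le_iff₀ (by positivity)]
  · exact e.norm_sub_le_of_capacity_image_le hlow hup hC.le (fun E hE => (h E hE).2) z w

theorem proposition1p2 (φ : ℂ → ℂ) (hφ : IsHomeomorph φ)
    (h : (∃ C : ℝ, 0 < C ∧ ∀ E : Set ℂ, IsCompact E →
            C⁻¹ * analyticCapacity E ≤ analyticCapacity (φ '' E) ∧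
            analyticCapacity (φ '' E) ≤ C * analyticCapacity E) ∨
         (∃ C : ℝ, 0 < C ∧ ∀ E : Set ℂ, IsCompact E →
            C⁻¹ * continuousAnalyticCapacity E ≤ continuousAnalyticCapacity (φ '' E) ∧
            continuousAnalyticCapacity (φ '' E) ≤ C * continuousAnalyticCapacity E)) :
    IsBilipschitz φ := by
  obtain ⟨C, hC, h⟩ | ⟨C, hC, h⟩ := h
  · refine hφ.isBilipschitz_of_capacity (fun K E hK hc hE hKE => ?_)
      (fun p R hR => analyticCapacity_closedBall_le p hR) hC h
    have h1 := hc.diam_le_analyticCapacity hK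
    have h2 := analyticCapacity_mono hE (hKE.trans interior_subset)
    linarith
  · refine hφ.isBilipschitz_of_capacity (fun K E hK hc hE hKE => ?_)
      (fun p R hR => (continuousAnalyticCapacity_le_analyticCapacity
        (isCompact_closedBall p R)).trans (analyticCapacity_closedBall_le p hR)) hC h
    have h1 := hc.diam_le_analyticCapacity hK
    have h2 := analyticCapacity_le_continuousAnalyticCapacity_of_subset_interior hE hKE
    linarith
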